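/- Let $M$ be a $3$-manifold with boundary $\partial M$ such that the pair $(M,\partial M)$ is homeomorphic either to the thickened torus $(\mathbb T\times[0,1],\ \mathbb T\times\{0,1\})$, where $\mathbb T=\mathbb S^1\times\mathbb S^1$, or to the solid torus $(\mathbb D\times\mathbb S^1,\ \partial\mathbb D\times\mathbb S^1)$, where $\mathbb D\subset\mathbb C$ is the closed unit disc. For a continuous map $K:M\to M$ that is the identity on $\partial M$, let $$\mathrm{var}_K: H_1(M,\partial M;\mathbb Z)\to H_1(M;\mathbb Z),\qquad [\delta]\mapsto [K(\delta)-\delta],$$ be its variation morphism, where $\delta$ runs over the singular $1$-chains of $M$ with boundary in $\partial M$. Let $\chi_0,\chi_1:M\to M$ be two homeomorphisms that are the identity on $\partial M$. Then $\chi_0$ and $\chi_1$ are homotopic relative to $\partial M$ (there is a continuous family of continuous maps $F_t:M\to M$, $t\in[0,1]$, with $F_0=\chi_0$, $F_1=\chi_1$ and $F_t(m)=m$ for all $m\in\partial M$ and all $t$) if and only if $\mathrm{var}_{\chi_0}=\mathrm{var}_{\chi_1}$. -/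

import Mathlib

open CategoryTheory CategoryTheory.Limits

noncomputable section

/-- The integral singular chain complex `C_•(X; ℤ)`. -/
abbrev singularChains (X : Type) [TopologicalSpace X] : ChainComplex (ModuleCat.{0} ℤ) ℕ :=
  ((AlgebraicTopology.singularChainComplexFunctor (ModuleCat.{0} ℤ)).obj
    (ModuleCat.of ℤ ℤ)).obj (TopCat.of X)

/-- The chain map `f_# : C_•(X; ℤ) ⟶ C_•(Y; ℤ)` induced by a continuous map `f : X → Y`. -/
abbrev singularChainsMap {X Y : Type} [TopologicalSpace X] [TopologicalSpace Y] (f : C(X, Y)) :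
    singularChains X ⟶ singularChains Y :=
  ((AlgebraicTopology.singularChainComplexFunctor (ModuleCat.{0} ℤ)).obj
    (ModuleCat.of ℤ ℤ)).map (TopCat.ofHom f)

/-- The inclusion of a subspace, as a continuous map. -/
abbrev subspaceInclusion {X : Type} [TopologicalSpace X] (A : Set X) : C(A, X) :=
  ⟨Subtype.val, continuous_subtype_val⟩

/-- The relative singular chain complex `C_•(X, A; ℤ) = C_•(X; ℤ) / C_•(A; ℤ)`. -/
abbrev relativeSingularChains (X : Type) [TopologicalSpace X] (A : Set X) :
    ChainComplex (ModuleCat.{0} ℤ) ℕ :=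
  cokernel (singularChainsMap (subspaceInclusion A))

/-- Singular homology `H_n(X; ℤ)`. -/
abbrev singularH (X : Type) [TopologicalSpace X] (n : ℕ) : ModuleCat.{0} ℤ :=
  (singularChains X).homology n

/-- Relative singular homology `H_n(X, A; ℤ)`. -/
abbrev relativeSingularH (X : Type) [TopologicalSpace X] (A : Set X) (n : ℕ) :
    ModuleCat.{0} ℤ :=
  (relativeSingularChains X A).homology n

/-- If `K : X → X` is the identity on `A`, then `K_# - id` vanishes on the chains of `A`. -/
theorem singularChainsMap_sub_id_eq_zero {X : Type} [TopologicalSpace X] {A : Set X}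
    (K : C(X, X)) (hK : ∀ a ∈ A, K a = a) :
    singularChainsMap (subspaceInclusion A) ≫ (singularChainsMap K - 𝟙 (singularChains X)) = 0 := by
  have h : TopCat.ofHom (subspaceInclusion A) ≫ TopCat.ofHom K
      = TopCat.ofHom (subspaceInclusion A) := by
    ext a
    exact hK a.1 a.2
  rw [Preadditive.comp_sub, Category.comp_id, ← Functor.map_comp, h, sub_self]

/-- The chain map `C_•(X, A; ℤ) ⟶ C_•(X; ℤ)`, `[δ] ↦ K_#(δ) - δ`, attached to a continuous map
`K : X → X` that is the identity on `A`. -/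
def variationChainMap {X : Type} [TopologicalSpace X] {A : Set X}
    (K : C(X, X)) (hK : ∀ a ∈ A, K a = a) : relativeSingularChains X A ⟶ singularChains X :=
  cokernel.desc (singularChainsMap (subspaceInclusion A))
    (singularChainsMap K - 𝟙 (singularChains X)) (singularChainsMap_sub_id_eq_zero K hK)

/-- The variation morphism `var_K : H_n(X, A; ℤ) ⟶ H_n(X; ℤ)`, `[δ] ↦ [K(δ) - δ]`, relative to `A`,
of a continuous map `K : X → X` that is the identity on `A`. -/
def variation {X : Type} [TopologicalSpace X] {A : Set X}
    (K : C(X, X)) (hK : ∀ a ∈ A, K a = a) (n : ℕ) : relativeSingularH X A n ⟶ singularH X n :=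
  HomologicalComplex.homologyMap (variationChainMap K hK) n

/-- `M` is a thickened torus with boundary `B`: the pair `(M, B)` is homeomorphic to
`(𝕋 × I, 𝕋 × ∂I)`, with `𝕋 = 𝕊¹ × 𝕊¹` and `I = [0, 1]`. -/
def IsThickenedTorus (M : Type) [TopologicalSpace M] (B : Set M) : Prop :=
  ∃ e : M ≃ₜ (Circle × Circle) × unitInterval, ∀ m : M, m ∈ B ↔ (e m).2 = 0 ∨ (e m).2 = 1

/-- `M` is a solid torus with boundary `B`: the pair `(M, B)` is homeomorphic to
`(𝔻 × 𝕊¹, ∂𝔻 × 𝕊¹)`, with `𝔻` the closed unit disc of `ℂ`. -/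
def IsSolidTorus (M : Type) [TopologicalSpace M] (B : Set M) : Prop :=
  ∃ e : M ≃ₜ Metric.closedBall (0 : ℂ) 1 × Circle, ∀ m : M, m ∈ B ↔ ‖((e m).1 : ℂ)‖ = 1

end

/-!
The variation of a map `K` fixing `A` is induced by `K_# - id`, and for a homotopy `F` fixing `A`
the chain maps `(F_t)_# - id` all factor through `F_# - pr_#` on the cylinder pair
`(I × X, I × A)`. The inclusions of `(X, A)` at the two ends of the cylinder agree in homology,
because both are sections of the projection, which is a quasi-isomorphism by the five lemma. Hence
homotopic maps have the same variation.

Conversely, a map `f : M → 𝕊¹` yields a homomorphism `H_1(M; ℤ) → ℝ`, the winding of `f` along a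
loop. If `var_p = var_q`, evaluating it on the variation of a path `γ` with endpoints in `∂M`
shows that the argument increases equally along `f ∘ p ∘ γ` and `f ∘ q ∘ γ`. On the thickened
torus, with the paths `γ = {x} × [0, 1]`, this says that the logarithm of `(f ∘ q) / (f ∘ p)` that
vanishes on one boundary component vanishes on the other. On the solid torus, `𝔻` is contractible
and `∂𝔻` connected, so a logarithm vanishing on the boundary always exists. Multiplying by the
exponential of `t` times this logarithm moves each circle coordinate of `p` to that of `q`; the
remaining coordinate lies in a convex set and moves along segments.
-/

open HomologicalComplex

noncomputable section

section FiveLemma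

variable {C ι : Type*} [Category* C] [Abelian C] {c : ComplexShape ι}

theorem quasiIso_cokernel_map {K L K' L' : HomologicalComplex C c} (i : K ⟶ L) (i' : K' ⟶ L')
    [Mono i] [Mono i'] (φ : K ⟶ K') (ψ : L ⟶ L') [QuasiIso φ] [QuasiIso ψ]
    (comm : i ≫ ψ = φ ≫ i') : QuasiIso (cokernel.map i i' φ ψ comm) := by
  let S : ShortComplex (HomologicalComplex C c) := .mk i (cokernel.π i) (cokernel.condition i)
  let S' : ShortComplex (HomologicalComplex C c) := .mk i' (cokernel.π i') (cokernel.condition i')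
  have hS : S.ShortExact := .mk (S.exact_of_g_is_cokernel (cokernelIsCokernel i))
  have hS' : S'.ShortExact := .mk (S'.exact_of_g_is_cokernel (cokernelIsCokernel i'))
  let Φ : S ⟶ S' := { τ₁ := φ, τ₂ := ψ, τ₃ := cokernel.map i i' φ ψ comm }
  exact HomologySequence.quasiIso_τ₃ Φ hS hS' ‹_› ‹_›

end FiveLemma

section HomotopyInvariance

variable {X Y Z : Type} [TopologicalSpace X] [TopologicalSpace Y] [TopologicalSpace Z]

theorem singularChainsMap_comp (f : C(X, Y)) (g : C(Y, Z)) :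
    singularChainsMap (g.comp f) = singularChainsMap f ≫ singularChainsMap g :=
  Functor.map_comp _ (TopCat.ofHom f) (TopCat.ofHom g)

theorem singularChainsMap_id : singularChainsMap (.id X) = 𝟙 (singularChains X) :=
  CategoryTheory.Functor.map_id _ (TopCat.of X)

theorem mono_singularChainsMap {f : C(X, Y)} (hf : Function.Injective f) :
    Mono (singularChainsMap f) :=
  have : Mono (TopCat.ofHom f) := (TopCat.mono_iff_injective _).2 hf
  Functor.map_mono _ _

theorem homologyMap_singularChainsMap_eq_of_homotopic {f g : C(X, Y)} (h : f.Homotopic g) (n : ℕ) :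
    homologyMap (singularChainsMap f) n = homologyMap (singularChainsMap g) n :=
  let ⟨H⟩ := h
  TopCat.Homotopy.congr_homologyMap_singularChainComplexFunctor H _ n

theorem quasiIso_singularChainsMap_of_homotopyEquiv (e : ContinuousMap.HomotopyEquiv X Y) :
    QuasiIso (singularChainsMap e.toFun) := by
  have hcomp {X Y : Type} [TopologicalSpace X] [TopologicalSpace Y]
      (e : ContinuousMap.HomotopyEquiv X Y) (n : ℕ) :
      homologyMap (singularChainsMap e.toFun) n ≫ homologyMap (singularChainsMap e.invFun) n =
        𝟙 _ := by
    rw [← homologyMap_comp, ← singularChainsMap_comp,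
      homologyMap_singularChainsMap_eq_of_homotopic e.left_inv, singularChainsMap_id,
      homologyMap_id]
  refine (quasiIso_iff _).2 fun n => (quasiIsoAt_iff_isIso_homologyMap _ n).2 ?_
  exact ⟨homologyMap (singularChainsMap e.invFun) n, hcomp e n, hcomp e.symm n⟩

theorem quasiIso_singularChainsMap_snd [ContractibleSpace Y] :
    QuasiIso (singularChainsMap (ContinuousMap.snd : C(Y × X, X))) := by
  obtain ⟨y, h⟩ := id_nullhomotopic Y
  let e : ContinuousMap.HomotopyEquiv (Y × X) X :=
    { toFun := .snd
      invFun := .prodMk (.const X y) (.id X)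
      left_inv := (h.symm.prodMap (.refl (.id X)) :)
      right_inv := .refl _ }
  exact quasiIso_singularChainsMap_of_homotopyEquiv e

end HomotopyInvariance

section RelativeCylinder

variable {X : Type} [TopologicalSpace X] (A : Set X)

instance : ContractibleSpace unitInterval :=
  (convex_Icc (0 : ℝ) 1).contractibleSpace ⟨0, by simp⟩

/-- The singular chain complex `C_•(I × X, I × A; ℤ)` of the cylinder on a pair `(X, A)`. Chains of
`I × A` enter through the inclusion of the product, rather than of a subset of `I × X`. -/
abbrev cylinderChains : ChainComplex (ModuleCat.{0} ℤ) ℕ :=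
  cokernel (singularChainsMap ((ContinuousMap.id unitInterval).prodMap (subspaceInclusion A)))

theorem singularChainsMap_id_prodMap_comp_snd :
    singularChainsMap ((ContinuousMap.id unitInterval).prodMap (subspaceInclusion A)) ≫
        singularChainsMap .snd =
      singularChainsMap .snd ≫ singularChainsMap (subspaceInclusion A) := by
  rw [← singularChainsMap_comp, ← singularChainsMap_comp]
  rfl

/-- The chain map induced by the projection of pairs `(I × X, I × A) → (X, A)`. -/
def cylinderProj : cylinderChains A ⟶ relativeSingularChains X A :=
  cokernel.map _ _ _ _ (singularChainsMap_id_prodMap_comp_snd A)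

/-- The chain map induced by the inclusion of pairs `(X, A) → (I × X, I × A)` at height `t`. -/
def cylinderSlice (t : unitInterval) : relativeSingularChains X A ⟶ cylinderChains A :=
  cokernel.map _ _ (singularChainsMap (.prodMk (.const A t) (.id A)))
    (singularChainsMap (.prodMk (.const X t) (.id X))) <| by
    rw [← singularChainsMap_comp, ← singularChainsMap_comp]; rfl

instance : QuasiIso (cylinderProj A) :=
  have := mono_singularChainsMap (f := subspaceInclusion A) Subtype.val_injective
  have := mono_singularChainsMap
    (f := (ContinuousMap.id unitInterval).prodMap (subspaceInclusion A))
    (Function.injective_id.prodMap Subtype.val_injective)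
  have := quasiIso_singularChainsMap_snd (X := X) (Y := unitInterval)
  have := quasiIso_singularChainsMap_snd (X := A) (Y := unitInterval)
  quasiIso_cokernel_map _ _ _ _ (singularChainsMap_id_prodMap_comp_snd A)

theorem cylinderSlice_comp_cylinderProj (t : unitInterval) :
    cylinderSlice A t ≫ cylinderProj A = 𝟙 _ := by
  apply coequalizer.hom_ext
  rw [cylinderSlice, cylinderProj, cokernel.π_desc_assoc, Category.assoc, cokernel.π_desc,
    ← Category.assoc, ← singularChainsMap_comp]
  exact (congrArg (· ≫ cokernel.π _) singularChainsMap_id).trans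
    ((Category.id_comp _).trans (Category.comp_id _).symm)

theorem homologyMap_cylinderSlice_eq (t u : unitInterval) (n : ℕ) :
    homologyMap (cylinderSlice A t) n = homologyMap (cylinderSlice A u) n := by
  rw [← cancel_mono (homologyMap (cylinderProj A) n), ← homologyMap_comp, ← homologyMap_comp,
    cylinderSlice_comp_cylinderProj, cylinderSlice_comp_cylinderProj]

variable {A}

/-- The chain map `C_•(I × X, I × A; ℤ) ⟶ C_•(X; ℤ)`, `[δ] ↦ F_#(δ) - pr_#(δ)`, attached to a
homotopy `F` that fixes `A` pointwise. -/
def cylinderVariation (F : C(unitInterval × X, X)) (hF : ∀ t, ∀ a ∈ A, F (t, a) = a) :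
    cylinderChains A ⟶ singularChains X :=
  cokernel.desc _ (singularChainsMap F - singularChainsMap .snd) <| by
    rw [Preadditive.comp_sub, ← singularChainsMap_comp, ← singularChainsMap_comp, sub_eq_zero]
    congr 1
    ext ⟨t, a⟩
    exact hF t a a.2

theorem cylinderSlice_comp_cylinderVariation (F : C(unitInterval × X, X))
    (hF : ∀ t, ∀ a ∈ A, F (t, a) = a) (t : unitInterval) :
    cylinderSlice A t ≫ cylinderVariation F hF =
      variationChainMap (F.comp (.prodMk (.const X t) (.id X))) (hF t) := by
  apply coequalizer.hom_ext
  unfold variationChainMap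
  rw [cylinderSlice, cylinderVariation, cokernel.π_desc_assoc, Category.assoc,
    cokernel.π_desc, cokernel.π_desc, Preadditive.comp_sub, ← singularChainsMap_comp,
    ← singularChainsMap_comp, ← singularChainsMap_id]
  rfl

theorem variation_eq_of_homotopicRel {f g : C(X, X)} (hf : ∀ a ∈ A, f a = a)
    (hg : ∀ a ∈ A, g a = a) (h : f.HomotopicRel g A) (n : ℕ) :
    variation f hf n = variation g hg n := by
  obtain ⟨F⟩ := h
  have hF (t : unitInterval) (a) (ha : a ∈ A) : F.toContinuousMap (t, a) = a :=
    (F.eq_fst t ha).trans (hf a ha)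
  have hslice (t : unitInterval) (K : C(X, X)) (hK : ∀ a ∈ A, K a = a)
      (hFK : ∀ x, F (t, x) = K x) :
      variation K hK n = homologyMap (cylinderSlice A t) n ≫
        homologyMap (cylinderVariation F.toContinuousMap hF) n := by
    obtain rfl : F.toContinuousMap.comp (.prodMk (.const X t) (.id X)) = K := ContinuousMap.ext hFK
    rw [← homologyMap_comp, cylinderSlice_comp_cylinderVariation, variation]
  rw [hslice 0 f hf F.apply_zero, hslice 1 g hg F.apply_one, homologyMap_cylinderSlice_eq A 0 1]

end RelativeCylinder

section Logarithm

variable {X Y : Type*} [TopologicalSpace X] [TopologicalSpace Y]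

theorem exists_circleExp_eq_of_eqOn_one [ContractibleSpace X] {A : Set X} (hA : IsConnected A)
    (k : C(X × Y, Circle)) (hk : ∀ a ∈ A, ∀ y, k (a, y) = 1) :
    ∃ L : C(X × Y, ℝ), (∀ z, Circle.exp (L z) = k z) ∧ ∀ a ∈ A, ∀ y, L (a, y) = 0 := by
  obtain ⟨a₀, ha₀⟩ := hA.nonempty
  obtain ⟨x₀, ⟨H⟩⟩ := id_nullhomotopic X
  -- Dividing by `k (x₀, y)` makes the homotopy start at `1`, wherever the contraction ends.
  let g : C(unitInterval × (X × Y), Circle) :=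
    ⟨fun w => k (H.symm (w.1, w.2.1), w.2.2) / k (x₀, w.2.2), by fun_prop⟩
  have hg₀ (z) : g (0, z) = Circle.exp (ContinuousMap.const (X × Y) (0 : ℝ) z) := by simp [g]
  let l : C(unitInterval × (X × Y), ℝ) := Circle.isCoveringMap_exp.liftHomotopy g _ hg₀
  have hlift (w) : Circle.exp (l w) = g w :=
    congrFun (Circle.isCoveringMap_exp.liftHomotopy_lifts g _ hg₀) w
  have hl (z : X × Y) : Circle.exp (l (1, z)) = k z / k (x₀, z.2) :=
    (hlift (1, z)).trans (by simp [g])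
  let L : C(X × Y, ℝ) := ⟨fun z => l (1, z) - l (1, a₀, z.2), by fun_prop⟩
  have hL (z : X × Y) : Circle.exp (L z) = k z := by simp [L, Circle.exp_sub, hl, hk a₀ ha₀]
  refine ⟨L, hL, fun a ha y => ?_⟩
  calc L (a, y) = L (a₀, y) :=
        Circle.isCoveringMap_exp.constOn_of_comp (g := fun x => L (x, y)) hA.isPreconnected
          (by fun_prop) (fun b hb b' hb' => by simp only [hL, hk b hb, hk b' hb']) ha ha₀
    _ = 0 := sub_self _

theorem exists_circleExp_eq [ContractibleSpace X] (f : C(X, Circle)) :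
    ∃ l : C(X, ℝ), ∀ x, Circle.exp (l x) = f x := by
  obtain ⟨x₀⟩ := (inferInstance : Nonempty X)
  obtain ⟨θ, hθ⟩ : ∃ θ, Circle.exp θ = f x₀ := ⟨_, Circle.exp_arg _⟩
  obtain ⟨L, hL, -⟩ := exists_circleExp_eq_of_eqOn_one (isConnected_singleton (x := x₀))
    (⟨fun z => f z.1 / f x₀, by fun_prop⟩ : C(X × Unit, Circle)) (by simp)
  exact ⟨⟨fun x => L (x, ()) + θ, by fun_prop⟩, fun x => by simp [Circle.exp_add, hL, hθ]⟩

variable [ContractibleSpace X] [ContractibleSpace Y]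

/-- The increment, from `x` to `y`, of a continuous determination of the argument of a circle-valued
map on a contractible space. -/
def argIncrement (f : C(X, Circle)) (x y : X) : ℝ :=
  (exists_circleExp_eq f).choose y - (exists_circleExp_eq f).choose x

theorem argIncrement_eq {f : C(X, Circle)} {l : C(X, ℝ)} (hl : ∀ x, Circle.exp (l x) = f x)
    (x y : X) : argIncrement f x y = l y - l x := by
  let l' := (exists_circleExp_eq f).choose
  have hl' : ∀ x, Circle.exp (l' x) = f x := (exists_circleExp_eq f).choose_spec
  have hconst : l' y - l y = l' x - l x :=
    Circle.isCoveringMap_exp.const_of_comp (l'.continuous.sub l.continuous)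
      (fun z w => by simp [Circle.exp_sub, hl, hl']) y x
  exact sub_eq_sub_iff_sub_eq_sub.2 hconst

theorem argIncrement_add_argIncrement (f : C(X, Circle)) (x y z : X) :
    argIncrement f x y + argIncrement f y z = argIncrement f x z :=
  sub_add_sub_cancel' _ _ _

theorem argIncrement_comp (f : C(Y, Circle)) (φ : C(X, Y)) (x y : X) :
    argIncrement (f.comp φ) x y = argIncrement f (φ x) (φ y) := by
  obtain ⟨l, hl⟩ := exists_circleExp_eq f
  rw [argIncrement_eq hl, argIncrement_eq (f := f.comp φ) (l := l.comp φ) fun x => hl (φ x)]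
  rfl

theorem argIncrement_div (f g : C(X, Circle)) (x y : X) :
    argIncrement (f / g) x y = argIncrement f x y - argIncrement g x y := by
  obtain ⟨l, hl⟩ := exists_circleExp_eq f
  obtain ⟨m, hm⟩ := exists_circleExp_eq g
  rw [argIncrement_eq hl, argIncrement_eq hm,
    argIncrement_eq (l := l - m) fun x => by simp [Circle.exp_sub, hl, hm]]
  exact sub_sub_sub_comm _ _ _ _

end Logarithm

section SingularSimplex

variable {X Y : Type} [TopologicalSpace X] [TopologicalSpace Y] {n : ℕ}

/-- The `i`-th face inclusion of standard topological simplices. -/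
def simplexFace (i : Fin (n + 2)) :
    C(stdSimplex ℝ (Fin (n + 1)), stdSimplex ℝ (Fin (n + 2))) :=
  ⟨stdSimplex.map i.succAbove, stdSimplex.continuous_map _⟩

/-- The singular chain consisting of a single simplex, encoded as the morphism from `ℤ` that sends
`1` to it. -/
def simplexChain (s : C(stdSimplex ℝ (Fin (n + 1)), X)) :
    ModuleCat.of ℤ ℤ ⟶ (singularChains X).X n :=
  SSet.ιChainComplex _ ((TopCat.toSSetObjEquiv (.of X) (.op (.mk n))).symm s)

theorem singularChains_hom_ext {T : ModuleCat.{0} ℤ} {u v : (singularChains X).X n ⟶ T}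
    (h : ∀ s, simplexChain s ≫ u = simplexChain s ≫ v) : u = v :=
  SSet.chainComplex_hom_ext (X := TopCat.toSSet.obj (.of X)) fun σ => by
    obtain ⟨s, rfl⟩ := (TopCat.toSSetObjEquiv (.of X) (.op (.mk n))).symm.surjective σ
    exact h s

theorem simplexChain_d (s : C(stdSimplex ℝ (Fin (n + 2)), X)) :
    simplexChain s ≫ (singularChains X).d (n + 1) n =
      ∑ i : Fin (n + 2), (-1) ^ i.val • simplexChain (s.comp (simplexFace i)) :=
  SSet.ιChainComplex_d _ _ _

theorem simplexChain_map (f : C(X, Y)) (s : C(stdSimplex ℝ (Fin (n + 1)), X)) :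
    simplexChain s ≫ (singularChainsMap f).f n = simplexChain (f.comp s) :=
  SSet.ι_chainComplexMap_f _ _ (TopCat.toSSet.map (TopCat.ofHom f)) _ _

/-- The singular cochain with prescribed values on simplices, as a homomorphism on chains. -/
def singularCochain {G : Type} [AddCommGroup G] (φ : C(stdSimplex ℝ (Fin (n + 1)), X) → G) :
    (singularChains X).X n ⟶ ModuleCat.of ℤ G :=
  Sigma.desc fun σ => ModuleCat.ofHom
    (LinearMap.toSpanSingleton ℤ G (φ (TopCat.toSSetObjEquiv (.of X) _ σ)))

theorem simplexChain_singularCochain {G : Type} [AddCommGroup G]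
    (φ : C(stdSimplex ℝ (Fin (n + 1)), X) → G) (s : C(stdSimplex ℝ (Fin (n + 1)), X)) :
    simplexChain s ≫ singularCochain φ = ModuleCat.ofHom (LinearMap.toSpanSingleton ℤ G (φ s)) := by
  refine (Sigma.ι_desc _ _).trans ?_
  rw [Equiv.apply_symm_apply]

end SingularSimplex

section RelativeSimplex

variable {X : Type} [TopologicalSpace X] {A : Set X} {n : ℕ}

theorem simplexChain_comp_cokernelπ_eq_zero {s : C(stdSimplex ℝ (Fin (n + 1)), X)}
    (hs : ∀ t, s t ∈ A) :
    simplexChain s ≫ (cokernel.π (singularChainsMap (subspaceInclusion A))).f n = 0 := by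
  let s' : C(stdSimplex ℝ (Fin (n + 1)), A) := ⟨fun t => ⟨s t, hs t⟩, by fun_prop⟩
  have hs' : simplexChain s = simplexChain s' ≫ (singularChainsMap (subspaceInclusion A)).f n :=
    (simplexChain_map (subspaceInclusion A) s').symm
  rw [hs', Category.assoc, ← comp_f, cokernel.condition, zero_f, comp_zero]

theorem simplexChain_relative_d_eq_zero {s : C(stdSimplex ℝ (Fin (n + 2)), X)}
    (hs : ∀ i t, s (simplexFace i t) ∈ A) :
    (simplexChain s ≫ (cokernel.π (singularChainsMap (subspaceInclusion A))).f (n + 1)) ≫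
      (relativeSingularChains X A).d (n + 1) n = 0 := by
  rw [Category.assoc, Hom.comm, reassoc_of% (simplexChain_d s), Preadditive.sum_comp]
  refine Finset.sum_eq_zero fun i _ => ?_
  rw [Preadditive.zsmul_comp, simplexChain_comp_cokernelπ_eq_zero (hs i), smul_zero]

/-- The class in `H_{n+1}(X, A; ℤ)` of a singular simplex with boundary in `A`, encoded as the
morphism from `ℤ` that sends `1` to it. -/
def relativeSimplexClass (s : C(stdSimplex ℝ (Fin (n + 2)), X))
    (hs : ∀ i t, s (simplexFace i t) ∈ A) :
    ModuleCat.of ℤ ℤ ⟶ relativeSingularH X A (n + 1) :=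
  (relativeSingularChains X A).liftCycles _ n (by simp) (simplexChain_relative_d_eq_zero hs) ≫
    (relativeSingularChains X A).homologyπ (n + 1)

theorem relativeSimplexClass_variation (K : C(X, X)) (hK : ∀ a ∈ A, K a = a)
    (s : C(stdSimplex ℝ (Fin (n + 2)), X)) (hs : ∀ i t, s (simplexFace i t) ∈ A) :
    relativeSimplexClass s hs ≫ variation K hK (n + 1) ≫ (singularChains X).homologyι (n + 1) =
      (simplexChain (K.comp s) - simplexChain s) ≫ (singularChains X).pOpcycles (n + 1) := by
  rw [relativeSimplexClass, variation, Category.assoc, homologyπ_naturality_assoc, homology_π_ι,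
    cyclesMap_i_assoc, liftCycles_i_assoc, Category.assoc, ← comp_f_assoc, variationChainMap,
    cokernel.π_desc, sub_f_apply, id_f, ← Category.assoc, Preadditive.comp_sub, simplexChain_map,
    Category.comp_id]

end RelativeSimplex

section Winding

variable {X : Type} [TopologicalSpace X]

instance (n : ℕ) : ContractibleSpace (stdSimplex ℝ (Fin (n + 1))) :=
  (convex_stdSimplex ℝ _).contractibleSpace ⟨_, single_mem_stdSimplex ℝ 0⟩

/-- The singular `1`-cochain that measures the variation of the argument of `f` along a path. -/
def windingCochain (f : C(X, Circle)) : (singularChains X).X 1 ⟶ ModuleCat.of ℤ ℝ :=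
  singularCochain fun s => argIncrement (f.comp s) (stdSimplex.vertex 0) (stdSimplex.vertex 1)

theorem argIncrement_comp_simplexFace {n : ℕ} (f : C(stdSimplex ℝ (Fin (n + 2)), Circle))
    (i : Fin (n + 2)) (a b : Fin (n + 1)) :
    argIncrement (f.comp (simplexFace i)) (stdSimplex.vertex a) (stdSimplex.vertex b) =
      argIncrement f (stdSimplex.vertex (i.succAbove a)) (stdSimplex.vertex (i.succAbove b)) := by
  rw [argIncrement_comp]
  simp only [simplexFace, ContinuousMap.coe_mk, stdSimplex.map_vertex]

theorem d_windingCochain (f : C(X, Circle)) :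
    (singularChains X).d 2 1 ≫ windingCochain f = 0 := by
  refine singularChains_hom_ext fun s => ?_
  let v (j : Fin 3) : stdSimplex ℝ (Fin 3) := stdSimplex.vertex j
  have hcocycle : argIncrement (f.comp s) (v 1) (v 2) - argIncrement (f.comp s) (v 0) (v 2) +
      argIncrement (f.comp s) (v 0) (v 1) = 0 := by
    rw [← argIncrement_add_argIncrement (f.comp s) (v 0) (v 1) (v 2)]
    ring
  rw [reassoc_of% (simplexChain_d s), Fin.sum_univ_three, comp_zero]
  simp only [windingCochain, Preadditive.add_comp, Preadditive.zsmul_comp,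
    simplexChain_singularCochain, ← ContinuousMap.comp_assoc, argIncrement_comp_simplexFace]
  refine ModuleCat.hom_ext (LinearMap.ext_ring ?_)
  simpa [Fin.succAbove, sub_eq_add_neg] using hcocycle

/-- The homomorphism `H_1(X; ℤ) ⟶ ℝ` that sends the class of a loop `γ` to `2π` times the degree of
`f ∘ γ`. -/
def windingHom (f : C(X, Circle)) : singularH X 1 ⟶ ModuleCat.of ℤ ℝ :=
  (singularChains X).homologyι 1 ≫
    (singularChains X).descOpcycles (windingCochain f) 2 (by simp) (d_windingCochain f)

variable {A : Set X}

theorem relativeSimplexClass_variation_windingHom (K : C(X, X)) (hK : ∀ a ∈ A, K a = a)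
    (s : C(stdSimplex ℝ (Fin 2), X)) (hs : ∀ i t, s (simplexFace i t) ∈ A) (f : C(X, Circle)) :
    (relativeSimplexClass s hs ≫ variation K hK 1 ≫ windingHom f).hom (1 : ℤ) =
      argIncrement (f.comp (K.comp s)) (stdSimplex.vertex 0) (stdSimplex.vertex 1) -
        argIncrement (f.comp s) (stdSimplex.vertex 0) (stdSimplex.vertex 1) := by
  have h := relativeSimplexClass_variation K hK s hs =≫
    (singularChains X).descOpcycles (windingCochain f) 2 (by simp) (d_windingCochain f)
  simp only [Category.assoc, p_descOpcycles, windingCochain, Preadditive.sub_comp,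
    simplexChain_singularCochain] at h
  simp only [windingHom, windingCochain]
  rw [h]
  simp

theorem argIncrement_eq_of_variation_eq {p q : C(X, X)} (hp : ∀ a ∈ A, p a = a)
    (hq : ∀ a ∈ A, q a = a) (h : variation p hp 1 = variation q hq 1) (f : C(X, Circle))
    {γ : C(unitInterval, X)} (h₀ : γ 0 ∈ A) (h₁ : γ 1 ∈ A) :
    argIncrement (f.comp (p.comp γ)) 0 1 = argIncrement (f.comp (q.comp γ)) 0 1 := by
  let e : C(stdSimplex ℝ (Fin 2), unitInterval) := stdSimplexHomeomorphUnitInterval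
  have he₀ : e (stdSimplex.vertex 0) = 0 := stdSimplexHomeomorphUnitInterval_zero
  have he₁ : e (stdSimplex.vertex 1) = 1 := stdSimplexHomeomorphUnitInterval_one
  have hs (i : Fin 2) (t : stdSimplex ℝ (Fin 1)) : (γ.comp e) (simplexFace i t) ∈ A := by
    rw [Subsingleton.elim t (stdSimplex.vertex 0)]
    fin_cases i <;> simpa [simplexFace, he₀, he₁]
  have hwinding := relativeSimplexClass_variation_windingHom p hp _ hs f
  rw [h, relativeSimplexClass_variation_windingHom q hq, sub_left_inj] at hwinding
  simp only [← ContinuousMap.comp_assoc, argIncrement_comp _ e, he₀, he₁] at hwinding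
  exact hwinding.symm

end Winding

section HomotopyRel

variable {X : Type*} [TopologicalSpace X] {A : Set X}

theorem homotopicRel_of_convex {E : Type*} [AddCommGroup E] [Module ℝ E] [TopologicalSpace E]
    [ContinuousAdd E] [ContinuousSMul ℝ E] {s : Set E} (hs : Convex ℝ s) {f g : C(X, s)}
    (h : ∀ x ∈ A, f x = g x) : f.HomotopicRel g A :=
  ⟨{toFun y := ⟨(1 - y.1.1) • (f y.2).1 + y.1.1 • (g y.2).1,
      hs (f y.2).2 (g y.2).2 (sub_nonneg.2 y.1.2.2) y.1.2.1 (sub_add_cancel _ _)⟩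
    continuous_toFun := by fun_prop
    map_zero_left x := Subtype.ext (by simp)
    map_one_left x := Subtype.ext (by simp)
    prop' t x hx := Subtype.ext (by simp [h x hx, ← add_smul])}⟩

theorem homotopicRel_of_circleExp_eq_div {f g : C(X, Circle)} (L : C(X, ℝ))
    (hL : ∀ x, Circle.exp (L x) = g x / f x) (hA : ∀ x ∈ A, L x = 0) : f.HomotopicRel g A :=
  ⟨{toFun y := f y.2 * Circle.exp (y.1 * L y.2)
    continuous_toFun := by fun_prop
    map_zero_left x := by simp
    map_one_left x := by simp [hL]
    prop' t x hx := by simp [hA x hx]}⟩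

end HomotopyRel

section Tori

variable {M : Type} [TopologicalSpace M] {B : Set M} {p q : C(M, M)}

theorem IsThickenedTorus.homotopicRel_comp (hM : IsThickenedTorus M B) (hp : ∀ m ∈ B, p m = m)
    (hq : ∀ m ∈ B, q m = m) (h : variation p hp 1 = variation q hq 1) (f : C(M, Circle)) :
    (f.comp p).HomotopicRel (f.comp q) B := by
  obtain ⟨e, he⟩ := hM
  have hB₀ (x : Circle × Circle) : e.symm (x, 0) ∈ B := by simp [he]
  have hB₁ (x : Circle × Circle) : e.symm (x, 1) ∈ B := by simp [he]
  let γ (x : Circle × Circle) : C(unitInterval, M) := ⟨fun t => e.symm (x, t), by fun_prop⟩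
  obtain ⟨L, hL, hL₀⟩ := exists_circleExp_eq_of_eqOn_one (isConnected_singleton (x := 0))
    (⟨fun y => f (q (e.symm y.swap)) / f (p (e.symm y.swap)), by fun_prop⟩ :
      C(unitInterval × (Circle × Circle), Circle)) (by simp [hp _ (hB₀ _), hq _ (hB₀ _)])
  have hL₁ (x : Circle × Circle) : L (1, x) = 0 := calc
    L (1, x) = L (1, x) - L (0, x) := by rw [hL₀ 0 rfl, sub_zero]
    _ = argIncrement (f.comp (q.comp (γ x)) / f.comp (p.comp (γ x))) 0 1 :=
      (argIncrement_eq (l := ⟨fun t => L (t, x), by fun_prop⟩) (fun t => hL (t, x)) 0 1).symm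
    _ = 0 := by
      rw [argIncrement_div, sub_eq_zero,
        argIncrement_eq_of_variation_eq hp hq h f (γ := γ x) (hB₀ x) (hB₁ x)]
  refine homotopicRel_of_circleExp_eq_div ⟨fun m => L (e m).swap, by fun_prop⟩
    (fun m => by simp [hL]) fun m hm => ?_
  rcases (he m).1 hm with h₀ | h₁
  · simpa [Prod.swap, h₀] using hL₀ 0 rfl _
  · simpa [Prod.swap, h₁] using hL₁ _

theorem isConnected_norm_eq_one :
    IsConnected {z : Metric.closedBall (0 : ℂ) 1 | ‖(z : ℂ)‖ = 1} := by
  have hrange : {z : Metric.closedBall (0 : ℂ) 1 | ‖(z : ℂ)‖ = 1} =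
      Set.range fun w : Circle => ⟨(w : ℂ), mem_closedBall_zero_iff.2 w.norm_coe.le⟩ := by
    ext z
    refine ⟨fun hz => ⟨⟨z, mem_sphere_zero_iff_norm.2 hz⟩, rfl⟩, ?_⟩
    rintro ⟨w, rfl⟩
    exact w.norm_coe
  rw [hrange]
  exact isConnected_range (by fun_prop)

theorem IsSolidTorus.homotopicRel_comp (hM : IsSolidTorus M B) (hp : ∀ m ∈ B, p m = m)
    (hq : ∀ m ∈ B, q m = m) (f : C(M, Circle)) : (f.comp p).HomotopicRel (f.comp q) B := by
  obtain ⟨e, he⟩ := hM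
  have := (convex_closedBall (0 : ℂ) 1).contractibleSpace ⟨0, by simp⟩
  obtain ⟨L, hL, hLB⟩ := exists_circleExp_eq_of_eqOn_one isConnected_norm_eq_one
    (⟨fun y => f (q (e.symm y)) / f (p (e.symm y)), by fun_prop⟩ :
      C(Metric.closedBall (0 : ℂ) 1 × Circle, Circle)) fun z hz w => by
        have hB : e.symm (z, w) ∈ B := (he _).2 (by simpa using hz)
        simp [hp _ hB, hq _ hB]
  exact homotopicRel_of_circleExp_eq_div ⟨fun m => L (e m), by fun_prop⟩ (fun m => by simp [hL])
    fun m hm => hLB _ ((he m).1 hm) _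

theorem homotopicRel_of_homeomorph_comp {X Y Z : Type*} [TopologicalSpace X] [TopologicalSpace Y]
    [TopologicalSpace Z] (e : Y ≃ₜ Z) {A : Set X} {f g : C(X, Y)}
    (h : ((e : C(Y, Z)).comp f).HomotopicRel ((e : C(Y, Z)).comp g) A) : f.HomotopicRel g A := by
  simpa [← ContinuousMap.comp_assoc] using h.comp_continuousMap (e.symm : C(Z, Y))

theorem IsThickenedTorus.homotopicRel_of_variation_eq (hM : IsThickenedTorus M B)
    (hp : ∀ m ∈ B, p m = m) (hq : ∀ m ∈ B, q m = m)
    (h : variation p hp 1 = variation q hq 1) : p.HomotopicRel q B := by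
  have hcircle := hM.homotopicRel_comp hp hq h
  obtain ⟨e, -⟩ := hM
  obtain ⟨H₁⟩ := hcircle ⟨fun m => (e m).1.1, by fun_prop⟩
  obtain ⟨H₂⟩ := hcircle ⟨fun m => (e m).1.2, by fun_prop⟩
  obtain ⟨H₃⟩ := homotopicRel_of_convex (A := B) (convex_Icc (0 : ℝ) 1)
    (f := ⟨fun m => (e (p m)).2, by fun_prop⟩) (g := ⟨fun m => (e (q m)).2, by fun_prop⟩)
    fun m hm => by simp [hp m hm, hq m hm]
  exact homotopicRel_of_homeomorph_comp e ⟨(H₁.prod H₂).prod H₃⟩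

theorem IsSolidTorus.homotopicRel (hM : IsSolidTorus M B) (hp : ∀ m ∈ B, p m = m)
    (hq : ∀ m ∈ B, q m = m) : p.HomotopicRel q B := by
  have hcircle := hM.homotopicRel_comp hp hq
  obtain ⟨e, -⟩ := hM
  obtain ⟨H₁⟩ := homotopicRel_of_convex (A := B) (convex_closedBall (0 : ℂ) 1)
    (f := ⟨fun m => (e (p m)).1, by fun_prop⟩) (g := ⟨fun m => (e (q m)).1, by fun_prop⟩)
    fun m hm => by simp [hp m hm, hq m hm]
  obtain ⟨H₂⟩ := hcircle ⟨fun m => (e m).2, by fun_prop⟩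
  exact homotopicRel_of_homeomorph_comp e ⟨H₁.prod H₂⟩

theorem proposition4p4_general (hM : IsThickenedTorus M B ∨ IsSolidTorus M B)
    (hp : ∀ m ∈ B, p m = m) (hq : ∀ m ∈ B, q m = m) :
    p.HomotopicRel q B ↔ variation p hp 1 = variation q hq 1 where
  mp h := variation_eq_of_homotopicRel hp hq h 1
  mpr h := hM.elim (·.homotopicRel_of_variation_eq hp hq h) (·.homotopicRel hp hq)

end Tori

end

theorem proposition4p4 (M : Type) [TopologicalSpace M] (B : Set M)
    (hM : IsThickenedTorus M B ∨ IsSolidTorus M B)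
    (χ₀ χ₁ : M ≃ₜ M) (h₀ : ∀ m ∈ B, χ₀ m = m) (h₁ : ∀ m ∈ B, χ₁ m = m) :
    ContinuousMap.HomotopicRel (χ₀ : C(M, M)) (χ₁ : C(M, M)) B ↔
      variation (χ₀ : C(M, M)) h₀ 1 = variation (χ₁ : C(M, M)) h₁ 1 :=
  proposition4p4_general hM h₀ h₁
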